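/- A rooted forest on $[n]=\{1,\dots,n\}$ is an unordered forest whose $n$ vertices are labeled bijectively by $[n]$ and in which every connected component has a distinguished root. A vertex $u$ is an ancestor of $v$ if $u$ lies on the path from the root of the component of $v$ to $v$. For a permutation $\pi=\pi(1)\cdots\pi(k)$ of $[k]$ (a pattern), the forest contains $\pi$ if there are vertices $v_1,\dots,v_k$ such that $v_i$ is an ancestor of $v_{i+1}$ for all $1\le i<k$ and the labels of $v_1,\dots,v_k$ are in the same relative order as $\pi(1),\dots,\pi(k)$; it avoids a set $S$ of patterns if it contains no $\pi\in S$. Let $f_n(S)$ be the number of rooted forests on $[n]$ that avoid $S$. Then for all $n\ge 0$, $$f_n(\{123,2413\})=f_n(\{132,2314\})\quad\text{and}\quad f_n(\{123,3142\})=f_n(\{132,3124\}).$$ That is, the classical forest-Wilf equivalences $\{123,2413\}\sim\{132,2314\}$ and $\{123,3142\}\sim\{132,3124\}$ hold. -/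

import Mathlib

/-- A rooted (unordered) labeled forest whose set of labels is `α`; each vertex is identified with
its label. It is given by its parent function (`none` at the roots), which is required to be
well-founded; for a finite `α` this says that there are no cycles. -/
@[ext]
structure RootedForest (α : Type*) where
  /-- The parent of a vertex, `none` if the vertex is a root. -/
  parent : α → Option α
  wf : WellFounded fun u v : α => parent v = some u

/-- A pattern: a permutation of `{1, …, length}` in one-line notation. -/
structure Pattern where
  /-- The number of entries. -/
  length : ℕ
  /-- The entries `π(1), …, π(length)`. -/
  word : Fin length → ℕ
  injective : Function.Injective word
  mem_Icc : ∀ i, word i ∈ Finset.Icc 1 length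

namespace RootedForest

variable {α : Type*}

instance [Finite α] : Finite (RootedForest α) :=
  Finite.of_injective RootedForest.parent fun _ _ h => RootedForest.ext h

/-- `u` is an ancestor of `v`: `u` lies on the path from the root to `v` (`u = v` is allowed). -/
def IsAncestor (F : RootedForest α) (u v : α) : Prop :=
  Relation.ReflTransGen (fun x y => F.parent y = some x) u v

/-- The sequence `v` of vertices is an instance of `π`: each term is an ancestor of the next one,
and the labels are in the same relative order as `π`. -/
def IsInstance [LinearOrder α] (F : RootedForest α) (π : Pattern) (v : Fin π.length → α) : Prop :=
  (∀ i j : Fin π.length, i.val + 1 = j.val → F.IsAncestor (v i) (v j)) ∧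
    ∀ i j : Fin π.length, v i < v j ↔ π.word i < π.word j

/-- The forest contains the pattern (classically). -/
def Contains [LinearOrder α] (F : RootedForest α) (π : Pattern) : Prop :=
  ∃ v : Fin π.length → α, F.IsInstance π v

/-- The forest avoids (classically) every pattern of the set `S`. -/
def Avoids [LinearOrder α] (F : RootedForest α) (S : Set Pattern) : Prop :=
  ∀ π ∈ S, ¬ F.Contains π

end RootedForest

/-- The number of rooted forests on `n` linearly ordered labels that avoid `S`. -/
noncomputable def forestCount (n : ℕ) (S : Set Pattern) : ℕ :=
  Nat.card {F : RootedForest (Fin n) // F.Avoids S}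

/-- Forest-Wilf equivalence of two sets of patterns. -/
def ForestWilfEquiv (S T : Set Pattern) : Prop :=
  ∀ n : ℕ, forestCount n S = forestCount n T

/-- The pattern `123`. -/
def pat123 : Pattern := ⟨3, ![1, 2, 3], by decide, by decide⟩

/-- The pattern `132`. -/
def pat132 : Pattern := ⟨3, ![1, 3, 2], by decide, by decide⟩

/-- The pattern `2413`. -/
def pat2413 : Pattern := ⟨4, ![2, 4, 1, 3], by decide, by decide⟩

/-- The pattern `2314`. -/
def pat2314 : Pattern := ⟨4, ![2, 3, 1, 4], by decide, by decide⟩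

/-- The pattern `3142`. -/
def pat3142 : Pattern := ⟨4, ![3, 1, 4, 2], by decide, by decide⟩

/-- The pattern `3124`. -/
def pat3124 : Pattern := ⟨4, ![3, 1, 2, 4], by decide, by decide⟩

/-! ### Labelings of a forest order -/

/-! Pairs of a forest and a relabeling of it can be counted by shape, so it suffices to compare, for
each fixed forest order `V`, the numbers of avoiding labelings of `V`. Both equivalences then follow
from one local move.

For a vertex `u` that is not a top-down minimum, let `D(u)` be the set of descendants of `u` (with
`u` itself) whose label exceeds that of some proper ancestor of `u`. A labeling avoids 123 iff every
such `u` has the largest label in `D(u)`, and avoids 132 iff it always has the smallest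
(`extremal_univ_iff`, `extremal_empty_iff`). `Extremal A` interpolates between the two: maximality
on `A`, minimality off `A`. A cyclic shift of the labels on `D(u)` takes `u` from smallest to
largest and keeps the order of the other vertices of `D(u)`. It preserves the top-down minima and
the extremality condition at every other vertex, so `A` can grow one vertex at a time
(`card_extremal_insert`).

The length-four patterns are handled by invariants of this move. `NoMinimumBetween` means avoidance
of 2413 at the 123 end and of 2314 at the 132 end; `SameSide` means avoidance of 3142 and of 3124
respectively. -/

namespace ForestLabeling

variable {V α : Type*} [PartialOrder V] [LinearOrder α]

/-- `d` is a descendant of `u` whose label exceeds that of some proper ancestor of `u`.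
In particular `Above l u u` says that `u` is not a top-down minimum. -/
def Above (l : V ≃ α) (u d : V) : Prop :=
  u ≤ d ∧ ∃ a, a < u ∧ l a < l d

/-- At every vertex `u` that is not a top-down minimum, the label of `u` is the largest among the
labels of `{d | Above l u d}` if `u ∈ A`, and the smallest if `u ∉ A`. -/
def Extremal (A : Set V) (l : V ≃ α) : Prop :=
  ∀ u d, Above l u u → Above l u d → (u ∈ A → l d ≤ l u) ∧ (u ∉ A → l u ≤ l d)

/-- There is no top-down minimum strictly between `u` and `d` when `Above l u d`. -/
def NoMinimumBetween (l : V ≃ α) : Prop :=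
  ∀ u c d, Above l u u → Above l u d → ¬ Above l c c → u < c → c < d → False

/-- For each top-down minimum `a` above `u`, all of `{d | Above l u d}` is on the same side
of `a`. -/
def SameSide (l : V ≃ α) : Prop :=
  ∀ a u d, a < u → Above l u u → Above l u d → ¬ Above l a a → (l a < l d ↔ l a < l u)

/-- The second labeling arises from the first by permuting the labels of
`{v | Above l u v}` in such a way that the relative order of the vertices other than `u` is kept. -/
structure Reshuffle (u : V) (l l' : V ≃ α) : Prop where
  self : Above l u u
  off : ∀ v, ¬ Above l u v → l' v = l v
  image : ∀ v, Above l u v → ∃ d, Above l u d ∧ l' v = l d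
  image_symm : ∀ v, Above l u v → ∃ d, Above l u d ∧ l v = l' d
  mono : ∀ v w, Above l u v → Above l u w → v ≠ u → w ≠ u → (l' v < l' w ↔ l v < l w)

/-- Membership in `{d | Above l u d}` is a label threshold among the descendants of `u`, so
permuting labels inside this set cannot alter a comparison with a descendant outside it. -/
theorem lt_of_above_of_not_above {l : V ≃ α} {u v d : V} (hd : Above l u d) (huv : u ≤ v)
    (hv : ¬ Above l u v) : l v < l d := by
  obtain ⟨-, a, ha, had⟩ := hd
  by_contra! h
  exact hv ⟨huv, a, ha, had.trans_le h⟩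

theorem le_of_not_above_self {l : V ≃ α} {a v : V} (hv : ¬ Above l v v) (ha : a < v) :
    l v ≤ l a := by
  by_contra! h
  exact hv ⟨le_rfl, a, ha, h⟩

/-! ### Invariants of a reshuffle at one vertex -/

namespace Reshuffle

variable {u : V} {l l' : V ≃ α}

theorem apply_of_not_le (h : Reshuffle u l l') {v : V} (hv : ¬ u ≤ v) : l' v = l v :=
  h.off v fun H => hv H.1

theorem above_iff (h : Reshuffle u l l') (v : V) : Above l' u v ↔ Above l u v := by
  by_cases hv : Above l u v
  · refine iff_of_true ⟨hv.1, ?_⟩ hv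
    obtain ⟨d, ⟨-, a, ha, had⟩, hd⟩ := h.image v hv
    exact ⟨a, ha, by rwa [hd, h.apply_of_not_le ha.not_ge]⟩
  · refine iff_of_false ?_ hv
    rintro ⟨huv, a, ha, hav⟩
    rw [h.off v hv, h.apply_of_not_le ha.not_ge] at hav
    exact hv ⟨huv, a, ha, hav⟩

theorem symm (h : Reshuffle u l l') : Reshuffle u l' l where
  self := (h.above_iff u).2 h.self
  off v hv := (h.off v (by rwa [← h.above_iff])).symm
  image v hv := by simpa only [h.above_iff] using h.image_symm v ((h.above_iff v).1 hv)
  image_symm v hv := by simpa only [h.above_iff] using h.image v ((h.above_iff v).1 hv)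
  mono v w hv hw hvu hwu :=
    (h.mono v w ((h.above_iff v).1 hv) ((h.above_iff w).1 hw) hvu hwu).symm

theorem lt_iff (h : Reshuffle u l l') {v w : V} (hv : u < v) (hw : u < w) :
    l' v < l' w ↔ l v < l w := by
  by_cases hv' : Above l u v <;> by_cases hw' : Above l u w
  · exact h.mono v w hv' hw' hv.ne' hw.ne'
  · refine iff_of_false (lt_of_above_of_not_above ?_ hw.le ?_).not_gt
      (lt_of_above_of_not_above hv' hw.le hw').not_gt
    · rwa [h.above_iff]
    · rwa [h.above_iff]
  · refine iff_of_true (lt_of_above_of_not_above ?_ hv.le ?_)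
      (lt_of_above_of_not_above hw' hv.le hv')
    · rwa [h.above_iff]
    · rwa [h.above_iff]
  · rw [h.off v hv', h.off w hw']

/-- If the witness `a` is strictly below `u` in the tree, only the order among proper descendants of
`u` matters. Otherwise `d` already lies in the reshuffled set of `u`, which is invariant; a witness
`a = u` is replaced by an ancestor with a smaller label, since `u` is not a top-down minimum. -/
theorem above_of_lt (h : Reshuffle u l l') (chain : ∀ a b c : V, a ≤ c → b ≤ c → a ≤ b ∨ b ≤ a)
    {w d : V} (hw : u < w) (hd : Above l w d) : Above l' w d := by
  obtain ⟨hwd, a, ha, had⟩ := hd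
  refine ⟨hwd, ?_⟩
  by_cases hua : u < a
  · exact ⟨a, ha, (h.lt_iff hua (hw.trans_le hwd)).2 had⟩
  have key : Above l u d := by
    rcases chain a u w ha.le hw.le with hau | hau
    · rcases hau.eq_or_lt with rfl | hau
      · obtain ⟨-, b, hb, hba⟩ := h.self
        exact ⟨hw.le.trans hwd, b, hb, hba.trans had⟩
      · exact ⟨hw.le.trans hwd, a, hau, had⟩
    · obtain rfl : u = a := by
        by_contra hne
        exact hua (lt_of_le_of_ne hau hne)
      obtain ⟨-, b, hb, hba⟩ := h.self
      exact ⟨hw.le.trans hwd, b, hb, hba.trans had⟩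
  obtain ⟨-, b, hb, hbd⟩ := (h.above_iff d).2 key
  exact ⟨b, hb.trans hw, hbd⟩

theorem above_iff_of_le (h : Reshuffle u l l')
    (chain : ∀ a b c : V, a ≤ c → b ≤ c → a ≤ b ∨ b ≤ a) {w : V} (hw : u ≤ w) (d : V) :
    Above l' w d ↔ Above l w d := by
  rcases hw.eq_or_lt with rfl | hw
  · exact h.above_iff d
  · exact ⟨h.symm.above_of_lt chain hw, h.above_of_lt chain hw⟩

/-- For `w` outside the subtree of `u`, a reshuffled `d` can be traded for the vertex `e` that held
its new label before: the labels of `w` and its ancestors did not move. -/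
theorem exists_above_of_not_le (h : Reshuffle u l l') {w d : V} (hw : ¬ u ≤ w)
    (hd : Above l' w d) (hud : Above l u d) (hwu : w ≤ u) :
    ∃ e, Above l w e ∧ Above l u e ∧ l' d = l e := by
  obtain ⟨e, he, hde⟩ := h.image d hud
  obtain ⟨-, a, ha, had⟩ := hd
  refine ⟨e, ⟨hwu.trans he.1, a, ha, ?_⟩, he, hde⟩
  rwa [hde, h.apply_of_not_le fun H => hw (H.trans ha.le)] at had

theorem above_of_not_le (h : Reshuffle u l l') {w d : V} (hw : ¬ u ≤ w)
    (hd : Above l' w d) (hud : ¬ Above l u d) : Above l w d := by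
  obtain ⟨hwd, a, ha, had⟩ := hd
  refine ⟨hwd, a, ha, ?_⟩
  rwa [h.off d hud, h.apply_of_not_le fun H => hw (H.trans ha.le)] at had

theorem above_self_iff (h : Reshuffle u l l')
    (chain : ∀ a b c : V, a ≤ c → b ≤ c → a ≤ b ∨ b ≤ a) (w : V) :
    Above l' w w ↔ Above l w w := by
  by_cases hw : u ≤ w
  · exact h.above_iff_of_le chain hw w
  · exact ⟨fun H => h.above_of_not_le hw H fun H' => hw H'.1,
      fun H => h.symm.above_of_not_le hw H fun H' => hw H'.1⟩

theorem extremal (h : Reshuffle u l l')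
    (chain : ∀ a b c : V, a ≤ c → b ≤ c → a ≤ b ∨ b ≤ a) {A B : Set V}
    (hAB : ∀ v, v ≠ u → (v ∈ A ↔ v ∈ B)) (hA : Extremal A l)
    (hu : ∀ d, Above l' u d → (u ∈ B → l' d ≤ l' u) ∧ (u ∉ B → l' u ≤ l' d)) :
    Extremal B l' := by
  intro w d hw hd
  rcases eq_or_ne w u with rfl | hwu
  · exact hu d hd
  rw [← hAB w hwu]
  rw [h.above_self_iff chain] at hw
  by_cases huw : u ≤ w
  · have huw' := lt_of_le_of_ne huw hwu.symm
    rw [h.above_iff_of_le chain huw] at hd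
    have := hA w d hw hd
    have hud := huw'.trans_le hd.1
    simpa only [← not_lt, h.lt_iff huw' hud, h.lt_iff hud huw'] using this
  · rw [h.apply_of_not_le huw]
    by_cases hud : Above l u d
    · have hwu' : w ≤ u := (chain w u d hd.1 hud.1).resolve_right huw
      obtain ⟨e, he, -, hde⟩ := h.exists_above_of_not_le huw hd hud hwu'
      rw [hde]
      exact hA w e hw he
    · rw [h.off d hud]
      exact hA w d hw (h.above_of_not_le huw hd hud)

/-- In the crucial case `d` is reshuffled and `w` is a proper ancestor of `u`. If `c` is an ancestor
of `u`, the old holder `e` of the label of `d` gives a bad triple `w, c, e` for `l`; otherwise `u,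
c, d` is already bad for `l`. -/
theorem noMinimumBetween (h : Reshuffle u l l')
    (chain : ∀ a b c : V, a ≤ c → b ≤ c → a ≤ b ∨ b ≤ a) (hl : NoMinimumBetween l) :
    NoMinimumBetween l' := by
  intro w c d hw hd hc hwc hcd
  rw [h.above_self_iff chain] at hw hc
  by_cases huw : u ≤ w
  · exact hl w c d hw ((h.above_iff_of_le chain huw d).1 hd) hc hwc hcd
  by_cases hud : Above l u d
  · have hwu : w ≤ u := (chain w u d hd.1 hud.1).resolve_right huw
    have hcu : c ≠ u := by
      rintro rfl
      exact hc h.self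
    rcases chain c u d hcd.le hud.1 with hc' | hc'
    · obtain ⟨e, he, hue, -⟩ := h.exists_above_of_not_le huw hd hud hwu
      exact hl w c e hw he hc hwc ((lt_of_le_of_ne hc' hcu).trans_le hue.1)
    · exact hl u c d h.self hud hc (lt_of_le_of_ne hc' hcu.symm) hcd
  · exact hl w c d hw (h.above_of_not_le huw hd hud) hc hwc hcd

/-- `SameSide` at `u` puts all the permuted labels on one side of the fixed label of `a`. -/
theorem lt_apply_iff (h : Reshuffle u l l') (hl : SameSide l) {a v : V} (ha : a < u)
    (hmin : ¬ Above l a a) : l' a < l' v ↔ l a < l v := by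
  rw [h.apply_of_not_le ha.not_ge]
  by_cases hv : Above l u v
  · obtain ⟨e, he, hve⟩ := h.image v hv
    rw [hve, hl a u e ha h.self he hmin, hl a u v ha h.self hv hmin]
  · rw [h.off v hv]

theorem sameSide (h : Reshuffle u l l')
    (chain : ∀ a b c : V, a ≤ c → b ≤ c → a ≤ b ∨ b ≤ a) (hl : SameSide l) :
    SameSide l' := by
  intro a w d haw hw hd ha
  rw [h.above_self_iff chain] at hw ha
  by_cases huw : u ≤ w
  · rw [h.above_iff_of_le chain huw] at hd
    have key := hl a w d haw hw hd ha
    have hau : a ≠ u := by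
      rintro rfl
      exact ha h.self
    rcases chain a u w haw.le huw with hau' | hau'
    · have hau' := lt_of_le_of_ne hau' hau
      rwa [h.lt_apply_iff hl hau' ha, h.lt_apply_iff hl hau' ha]
    · have hua := lt_of_le_of_ne hau' hau.symm
      rwa [h.lt_iff hua (hua.trans (haw.trans_le hd.1)), h.lt_iff hua (hua.trans haw)]
  · rw [h.apply_of_not_le huw, h.apply_of_not_le fun H => huw (H.trans haw.le)]
    by_cases hud : Above l u d
    · have hwu : w ≤ u := (chain w u d hd.1 hud.1).resolve_right huw
      obtain ⟨e, he, -, hde⟩ := h.exists_above_of_not_le huw hd hud hwu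
      rw [hde]
      exact hl a w e haw hw he ha
    · rw [h.off d hud]
      exact hl a w d haw hw (h.above_of_not_le huw hd hud) ha

end Reshuffle

/-! ### Moving the largest label of a finite set to the bottom -/

theorem finRotate_symm_val {k : ℕ} (i : Fin (k + 1)) :
    ((finRotate (k + 1)).symm i).val = if i.val = 0 then k else i.val - 1 := by
  obtain ⟨j, rfl⟩ := (finRotate (k + 1)).surjective i
  rw [Equiv.symm_apply_apply]
  rcases eq_or_ne j (Fin.last k) with rfl | hj
  · simp
  · rw [coe_finRotate_of_ne_last hj]
    simp

/-- On a finite set `Y` of labels there is a permutation that sends the least element to the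
largest one and each other element to its predecessor in `Y`. -/
theorem exists_cyclic_shift (Y : Finset α) : ∃ t : Equiv.Perm α,
    (∀ x, t x ∈ Y ↔ x ∈ Y) ∧ (∀ x, x ∉ Y → t x = x) ∧
    (∀ x ∈ Y, (∀ y ∈ Y, x ≤ y) ↔ ∀ y ∈ Y, y ≤ t x) ∧
    (∀ x ∈ Y, ∀ y ∈ Y, (¬ ∀ z ∈ Y, x ≤ z) → (¬ ∀ z ∈ Y, y ≤ z) → (t x < t y ↔ x < y)) := by
  obtain hY | ⟨k, hk⟩ : Y.card = 0 ∨ ∃ k, Y.card = k + 1 := by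
    cases h : Y.card <;> simp
  · obtain rfl := Finset.card_eq_zero.1 hY
    exact ⟨1, by simp⟩
  -- `e` lists `Y` increasingly; the inverse rotation sends index `0` to `k` and every other `i` to
  -- `i - 1`.
  let e := Y.orderIsoOfFin hk
  let s : Equiv.Perm Y := (e.symm.toEquiv.trans (finRotate (k + 1)).symm).trans e.toEquiv
  have hs (i) : Equiv.Perm.ofSubtype s (e i : α) = e ((finRotate (k + 1)).symm i) := by
    rw [Equiv.Perm.ofSubtype_apply_coe]
    simp [s]
  have hrange : ∀ x ∈ Y, ∃ i, (e i : α) = x := fun x hx => ⟨e.symm ⟨x, hx⟩, by simp⟩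
  have hall (P : α → Prop) : (∀ y ∈ Y, P y) ↔ ∀ i, P (e i) :=
    ⟨fun h i => h _ (e i).2, fun h y hy => by
      obtain ⟨i, rfl⟩ := hrange y hy
      exact h i⟩
  have hle (i j) : (e i : α) ≤ e j ↔ i ≤ j := by
    rw [Subtype.coe_le_coe, e.le_iff_le]
  have hlt (i j) : (e i : α) < e j ↔ i < j := by
    rw [Subtype.coe_lt_coe, e.lt_iff_lt]
  have hzero (i : Fin (k + 1)) : (∀ j, i ≤ j) ↔ i.val = 0 :=
    ⟨fun h => by simpa using h 0, fun h j => by simp [Fin.le_def, h]⟩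
  refine ⟨Equiv.Perm.ofSubtype s, fun x => Equiv.Perm.ofSubtype_apply_mem_iff_mem s x,
    fun x hx => Equiv.Perm.ofSubtype_apply_of_not_mem s hx, ?_, ?_⟩
  · intro x hx
    obtain ⟨i, rfl⟩ := hrange x hx
    rw [hall, hall, hs]
    simp only [hle, hzero]
    constructor
    · intro h j
      rw [Fin.le_def, finRotate_symm_val, if_pos h]
      omega
    · intro h
      have := h (Fin.last k)
      rw [Fin.le_def, finRotate_symm_val, Fin.val_last] at this
      split_ifs at this <;> omega
  · intro x hx y hy hx' hy'
    obtain ⟨i, rfl⟩ := hrange x hx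
    obtain ⟨j, rfl⟩ := hrange y hy
    rw [hall] at hx' hy'
    simp only [hle, hzero] at hx' hy'
    rw [hs, hs, hlt, hlt, Fin.lt_def, Fin.lt_def, finRotate_symm_val, finRotate_symm_val,
      if_neg hx', if_neg hy']
    omega
end ForestLabeling

/-! ### Raising and lowering the label of one vertex -/

namespace ForestLabeling

variable {V α : Type*} [PartialOrder V] [LinearOrder α]

theorem Reshuffle.trans_perm {u : V} {l : V ≃ α} (hu : Above l u u) (s : Equiv.Perm α)
    (hmem : ∀ v, Above l u (l.symm (s (l v))) ↔ Above l u v)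
    (hoff : ∀ v, ¬ Above l u v → s (l v) = l v)
    (hmono : ∀ v w, Above l u v → Above l u w → v ≠ u → w ≠ u →
      (s (l v) < s (l w) ↔ l v < l w)) : Reshuffle u l (l.trans s) where
  self := hu
  off := hoff
  image v hv := ⟨l.symm (s (l v)), (hmem v).2 hv, by simp⟩
  image_symm v hv := ⟨l.symm (s.symm (l v)), by
    rw [← hmem]
    simpa using hv, by simp⟩
  mono := hmono

/-- `Extremal` imposes nothing at a top-down minimum, so membership of `u` in the set is irrelevant
there. -/
theorem extremal_congr_of_not_above {u : V} {l : V ≃ α} {A B : Set V}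
    (hAB : ∀ v, v ≠ u → (v ∈ A ↔ v ∈ B)) (hu : ¬ Above l u u) (hA : Extremal A l) :
    Extremal B l := by
  intro w d hw hd
  rw [← hAB w (by rintro rfl; exact hu hw)]
  exact hA w d hw hd

variable [Finite V]

/-- The labels of the vertices `d` with `Above l u d`. -/
noncomputable def labelsAbove (l : V ≃ α) (u : V) : Finset α :=
  (Set.toFinite (l '' {d | Above l u d})).toFinset

theorem mem_labelsAbove {l : V ≃ α} {u : V} {x : α} :
    x ∈ labelsAbove l u ↔ Above l u (l.symm x) := by
  simp [labelsAbove]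

theorem apply_mem_labelsAbove {l : V ≃ α} {u v : V} :
    l v ∈ labelsAbove l u ↔ Above l u v := by
  simp [mem_labelsAbove]

theorem forall_mem_labelsAbove {l : V ≃ α} {u : V} {P : α → Prop} :
    (∀ x ∈ labelsAbove l u, P x) ↔ ∀ v, Above l u v → P (l v) := by
  simp only [labelsAbove, Set.Finite.mem_toFinset, Set.forall_mem_image, Set.mem_ofPred_eq]

theorem Reshuffle.labelsAbove_eq {u : V} {l l' : V ≃ α} (h : Reshuffle u l l') :
    labelsAbove l' u = labelsAbove l u := by
  ext x
  simp only [labelsAbove, Set.Finite.mem_toFinset, Set.mem_image, Set.mem_ofPred_eq, h.above_iff]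
  constructor
  · rintro ⟨v, hv, rfl⟩
    obtain ⟨d, hd, hvd⟩ := h.image v hv
    exact ⟨d, hd, hvd.symm⟩
  · rintro ⟨v, hv, rfl⟩
    obtain ⟨d, hd, hvd⟩ := h.image_symm v hv
    exact ⟨d, hd, hvd.symm⟩

/-- The cyclic shift of a finite set of labels that moves the least one to the top. -/
noncomputable def cyclicShift (Y : Finset α) : Equiv.Perm α :=
  (exists_cyclic_shift Y).choose

theorem cyclicShift_mem_iff (Y : Finset α) (x : α) : cyclicShift Y x ∈ Y ↔ x ∈ Y :=
  (exists_cyclic_shift Y).choose_spec.1 x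

theorem cyclicShift_of_notMem {Y : Finset α} {x : α} (hx : x ∉ Y) : cyclicShift Y x = x :=
  (exists_cyclic_shift Y).choose_spec.2.1 x hx

theorem isLeast_iff_cyclicShift {Y : Finset α} {x : α} (hx : x ∈ Y) :
    (∀ y ∈ Y, x ≤ y) ↔ ∀ y ∈ Y, y ≤ cyclicShift Y x :=
  (exists_cyclic_shift Y).choose_spec.2.2.1 x hx

theorem cyclicShift_lt_iff {Y : Finset α} {x y : α} (hx : x ∈ Y) (hy : y ∈ Y)
    (hx' : ¬ ∀ z ∈ Y, x ≤ z) (hy' : ¬ ∀ z ∈ Y, y ≤ z) :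
    cyclicShift Y x < cyclicShift Y y ↔ x < y :=
  (exists_cyclic_shift Y).choose_spec.2.2.2 x hx y hy hx' hy'

theorem reshuffle_raise {u : V} {l : V ≃ α} (hu : Above l u u)
    (hmin : ∀ d, Above l u d → l u ≤ l d) :
    Reshuffle u l (l.trans (cyclicShift (labelsAbove l u))) := by
  have hne (v : V) (hv : Above l u v) (hvu : v ≠ u) : ¬ ∀ z ∈ labelsAbove l u, l v ≤ z := by
    intro H
    exact hvu (l.injective ((forall_mem_labelsAbove.1 H u hu).antisymm (hmin v hv)))
  refine .trans_perm hu _ (fun v => ?_) (fun v hv => ?_) fun v w hv hw hvu hwu => ?_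
  · rw [← mem_labelsAbove, cyclicShift_mem_iff, apply_mem_labelsAbove]
  · exact cyclicShift_of_notMem (by rwa [apply_mem_labelsAbove])
  · exact cyclicShift_lt_iff (by rwa [apply_mem_labelsAbove]) (by rwa [apply_mem_labelsAbove])
      (hne v hv hvu) (hne w hw hwu)

theorem reshuffle_lower {u : V} {l : V ≃ α} (hu : Above l u u)
    (hmax : ∀ d, Above l u d → l d ≤ l u) :
    Reshuffle u l (l.trans (cyclicShift (labelsAbove l u)).symm) := by
  set t := cyclicShift (labelsAbove l u) with ht
  have hmem (x : α) : t.symm x ∈ labelsAbove l u ↔ x ∈ labelsAbove l u := by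
    rw [← cyclicShift_mem_iff, ← ht, Equiv.apply_symm_apply]
  have hne (v : V) (hv : Above l u v) (hvu : v ≠ u) :
      ¬ ∀ z ∈ labelsAbove l u, t.symm (l v) ≤ z := by
    intro H
    rw [isLeast_iff_cyclicShift (by rwa [hmem, apply_mem_labelsAbove]), ← ht,
      Equiv.apply_symm_apply] at H
    exact hvu (l.injective ((hmax v hv).antisymm (forall_mem_labelsAbove.1 H u hu)))
  refine .trans_perm hu _ (fun v => ?_) (fun v hv => ?_) fun v w hv hw hvu hwu => ?_
  · rw [← mem_labelsAbove, hmem, apply_mem_labelsAbove]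
  · rw [Equiv.symm_apply_eq]
    exact (cyclicShift_of_notMem (by rwa [apply_mem_labelsAbove])).symm
  · rw [← cyclicShift_lt_iff ((hmem _).2 (apply_mem_labelsAbove.2 hv))
      ((hmem _).2 (apply_mem_labelsAbove.2 hw)) (hne v hv hvu) (hne w hw hwu), ← ht,
      Equiv.apply_symm_apply, Equiv.apply_symm_apply]

theorem raise_max {u : V} {l : V ≃ α} (hu : Above l u u)
    (hmin : ∀ d, Above l u d → l u ≤ l d) (d : V)
    (hd : Above (l.trans (cyclicShift (labelsAbove l u))) u d) :
    l.trans (cyclicShift (labelsAbove l u)) d ≤ l.trans (cyclicShift (labelsAbove l u)) u := by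
  have h := reshuffle_raise hu hmin
  have := (isLeast_iff_cyclicShift (apply_mem_labelsAbove.2 hu)).1 (forall_mem_labelsAbove.2 hmin)
  rw [← h.labelsAbove_eq] at this
  simpa [h.labelsAbove_eq] using forall_mem_labelsAbove.1 this d hd

theorem lower_min {u : V} {l : V ≃ α} (hu : Above l u u)
    (hmax : ∀ d, Above l u d → l d ≤ l u) (d : V)
    (hd : Above (l.trans (cyclicShift (labelsAbove l u)).symm) u d) :
    l.trans (cyclicShift (labelsAbove l u)).symm u ≤
      l.trans (cyclicShift (labelsAbove l u)).symm d := by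
  have h := reshuffle_lower hu hmax
  have hmem : (cyclicShift (labelsAbove l u)).symm (l u) ∈ labelsAbove l u := by
    rw [← cyclicShift_mem_iff, Equiv.apply_symm_apply, apply_mem_labelsAbove]
    exact hu
  have := (isLeast_iff_cyclicShift hmem).2 (by
    rw [Equiv.apply_symm_apply]
    exact forall_mem_labelsAbove.2 hmax)
  rw [← h.labelsAbove_eq] at this
  simpa [h.labelsAbove_eq] using forall_mem_labelsAbove.1 this d hd

open Classical in
/-- Changing the requirement at one vertex from minimality to maximality keeps the number of
labelings. -/
theorem card_extremal_insert (chain : ∀ a b c : V, a ≤ c → b ≤ c → a ≤ b ∨ b ≤ a)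
    {Q : (V ≃ α) → Prop} (hQ : ∀ u l l', Reshuffle u l l' → Q l → Q l') {A : Set V} {u : V}
    (huA : u ∉ A) :
    Nat.card {l : V ≃ α // Q l ∧ Extremal A l} =
      Nat.card {l : V ≃ α // Q l ∧ Extremal (insert u A) l} := by
  have hAB (v : V) (hv : v ≠ u) : v ∈ A ↔ v ∈ insert u A := by simp [hv]
  have hmin {l : V ≃ α} (hl : Extremal A l) (hu : Above l u u) (d : V) (hd : Above l u d) :
      l u ≤ l d := (hl u d hu hd).2 huA
  have hmax {l : V ≃ α} (hl : Extremal (insert u A) l) (hu : Above l u u) (d : V)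
      (hd : Above l u d) : l d ≤ l u := (hl u d hu hd).1 (Set.mem_insert u A)
  refine Nat.card_congr
    { toFun := fun l => if hu : Above l.1 u u then
        ⟨l.1.trans (cyclicShift (labelsAbove l.1 u)), ?_⟩ else ⟨l.1, ?_⟩
      invFun := fun l => if hu : Above l.1 u u then
        ⟨l.1.trans (cyclicShift (labelsAbove l.1 u)).symm, ?_⟩ else ⟨l.1, ?_⟩
      left_inv := ?_
      right_inv := ?_ }
  · have h := reshuffle_raise hu (hmin l.2.2 hu)
    exact ⟨hQ _ _ _ h l.2.1, h.extremal chain hAB l.2.2 fun d hd =>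
      ⟨fun _ => raise_max hu (hmin l.2.2 hu) d hd, fun H => absurd (Set.mem_insert u A) H⟩⟩
  · exact ⟨l.2.1, extremal_congr_of_not_above hAB hu l.2.2⟩
  · have h := reshuffle_lower hu (hmax l.2.2 hu)
    exact ⟨hQ _ _ _ h l.2.1, h.extremal chain (fun v hv => (hAB v hv).symm) l.2.2 fun d hd =>
      ⟨fun H => absurd H huA, fun _ => lower_min hu (hmax l.2.2 hu) d hd⟩⟩
  · exact ⟨l.2.1, extremal_congr_of_not_above (fun v hv => (hAB v hv).symm) hu l.2.2⟩
  · rintro ⟨l, hl⟩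
    by_cases hu : Above l u u
    · have h := reshuffle_raise hu (hmin hl.2 hu)
      ext v
      simp [hu, h.symm.self, h.labelsAbove_eq]
    · simp [hu]
  · rintro ⟨l, hl⟩
    by_cases hu : Above l u u
    · have h := reshuffle_lower hu (hmax hl.2 hu)
      ext v
      simp [hu, h.symm.self, h.labelsAbove_eq]
    · simp [hu]

/-- The predicate `Q` stands for whichever invariant encodes the pattern of length four. -/
theorem card_extremal_univ (chain : ∀ a b c : V, a ≤ c → b ≤ c → a ≤ b ∨ b ≤ a)
    {Q : (V ≃ α) → Prop} (hQ : ∀ u l l', Reshuffle u l l' → Q l → Q l') :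
    Nat.card {l : V ≃ α // Q l ∧ Extremal Set.univ l} =
      Nat.card {l : V ≃ α // Q l ∧ Extremal ∅ l} := by
  refine Set.Finite.induction_on (motive := fun A _ =>
    Nat.card {l : V ≃ α // Q l ∧ Extremal A l} = Nat.card {l : V ≃ α // Q l ∧ Extremal ∅ l})
    _ Set.finite_univ rfl ?_
  intro u A huA _ ih
  rw [← card_extremal_insert chain hQ huA, ih]

/-! ### Patterns in terms of extremality -/

theorem exists_minimum_le (l : V ≃ α) (v : V) : ∃ a ≤ v, ¬ Above l a a ∧ l a ≤ l v := by
  obtain ⟨a, ha, hmin⟩ := Set.exists_min_image (Set.Iic v) l (Set.toFinite _) ⟨v, le_rfl⟩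
  refine ⟨a, ha, ?_, hmin v le_rfl⟩
  rintro ⟨-, b, hb, hba⟩
  exact (hmin b (hb.le.trans ha)).not_gt hba

end ForestLabeling

namespace ForestLabeling

theorem lt_of_le_of_label_ne {V α : Type*} [PartialOrder V] {l : V ≃ α} {a b : V} (h : a ≤ b)
    (hl : l a ≠ l b) : a < b :=
  lt_of_le_of_ne h fun H => hl (H ▸ rfl)

variable {V α : Type*} [PartialOrder V] [LinearOrder α]

/-- The pattern `π` occurs along a chain of `V` under the labeling `l`. -/
def Occurs (l : V ≃ α) (π : Pattern) : Prop :=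
  ∃ v : Fin π.length → V, (∀ i j : Fin π.length, i.val + 1 = j.val → v i ≤ v j) ∧
    ∀ i j : Fin π.length, l (v i) < l (v j) ↔ π.word i < π.word j

/-- Ancestry is weak in `Occurs`, but consecutive terms carry different labels, so it is
automatically strict; the same holds for the other patterns. -/
theorem occurs_pat123_iff {l : V ≃ α} :
    Occurs l pat123 ↔ ∃ a b c, a < b ∧ b < c ∧ l a < l b ∧ l b < l c := by
  constructor
  · rintro ⟨(v : Fin 3 → V), (hv : ∀ i j : Fin 3, i.val + 1 = j.val → v i ≤ v j), hl⟩
    change ∀ i j : Fin 3, _ ↔ (![1, 2, 3] : Fin 3 → ℕ) i < (![1, 2, 3] : Fin 3 → ℕ) j at hl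
    have h01 : l (v 0) < l (v 1) := (hl 0 1).2 (by decide)
    have h12 : l (v 1) < l (v 2) := (hl 1 2).2 (by decide)
    exact ⟨v 0, v 1, v 2, lt_of_le_of_label_ne (hv 0 1 rfl) h01.ne,
      lt_of_le_of_label_ne (hv 1 2 rfl) h12.ne, h01, h12⟩
  · rintro ⟨a, b, c, hab, hbc, h1, h2⟩
    refine ⟨![a, b, c], ?_, ?_⟩
    · change ∀ i j : Fin 3, _
      simp [Fin.forall_fin_succ, hab.le, hbc.le]
    · change ∀ i j : Fin 3, _ ↔ (![1, 2, 3] : Fin 3 → ℕ) i < (![1, 2, 3] : Fin 3 → ℕ) j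
      simp [Fin.forall_fin_succ, h1, h2, h1.trans h2, h1.le, h2.le, (h1.trans h2).le]

theorem occurs_pat132_iff {l : V ≃ α} :
    Occurs l pat132 ↔ ∃ a b c, a < b ∧ b < c ∧ l a < l c ∧ l c < l b := by
  constructor
  · rintro ⟨(v : Fin 3 → V), (hv : ∀ i j : Fin 3, i.val + 1 = j.val → v i ≤ v j), hl⟩
    change ∀ i j : Fin 3, _ ↔ (![1, 3, 2] : Fin 3 → ℕ) i < (![1, 3, 2] : Fin 3 → ℕ) j at hl
    have h02 : l (v 0) < l (v 2) := (hl 0 2).2 (by decide)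
    have h21 : l (v 2) < l (v 1) := (hl 2 1).2 (by decide)
    exact ⟨v 0, v 1, v 2, lt_of_le_of_label_ne (hv 0 1 rfl) (h02.trans h21).ne,
      lt_of_le_of_label_ne (hv 1 2 rfl) h21.ne', h02, h21⟩
  · rintro ⟨a, b, c, hab, hbc, h1, h2⟩
    refine ⟨![a, b, c], ?_, ?_⟩
    · change ∀ i j : Fin 3, _
      simp [Fin.forall_fin_succ, hab.le, hbc.le]
    · change ∀ i j : Fin 3, _ ↔ (![1, 3, 2] : Fin 3 → ℕ) i < (![1, 3, 2] : Fin 3 → ℕ) j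
      simp [Fin.forall_fin_succ, h1, h2, h1.trans h2, h1.le, h2.le, (h1.trans h2).le]

theorem occurs_pat2413_iff {l : V ≃ α} : Occurs l pat2413 ↔
    ∃ a b c d, a < b ∧ b < c ∧ c < d ∧ l c < l a ∧ l a < l d ∧ l d < l b := by
  constructor
  · rintro ⟨(v : Fin 4 → V), (hv : ∀ i j : Fin 4, i.val + 1 = j.val → v i ≤ v j), hl⟩
    change ∀ i j : Fin 4, _ ↔ (![2, 4, 1, 3] : Fin 4 → ℕ) i < (![2, 4, 1, 3] : Fin 4 → ℕ) j at hl
    have h20 : l (v 2) < l (v 0) := (hl 2 0).2 (by decide)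
    have h03 : l (v 0) < l (v 3) := (hl 0 3).2 (by decide)
    have h31 : l (v 3) < l (v 1) := (hl 3 1).2 (by decide)
    exact ⟨v 0, v 1, v 2, v 3, lt_of_le_of_label_ne (hv 0 1 rfl) (h03.trans h31).ne,
      lt_of_le_of_label_ne (hv 1 2 rfl) (h20.trans (h03.trans h31)).ne',
      lt_of_le_of_label_ne (hv 2 3 rfl) (h20.trans h03).ne, h20, h03, h31⟩
  · rintro ⟨a, b, c, d, hab, hbc, hcd, h1, h2, h3⟩
    have h12 := h1.trans h2
    have h23 := h2.trans h3
    have h123 := h1.trans h23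
    refine ⟨![a, b, c, d], ?_, ?_⟩
    · change ∀ i j : Fin 4, _
      simp [Fin.forall_fin_succ, hab.le, hbc.le, hcd.le]
    · change ∀ i j : Fin 4, _ ↔ (![2, 4, 1, 3] : Fin 4 → ℕ) i < (![2, 4, 1, 3] : Fin 4 → ℕ) j
      simp [Fin.forall_fin_succ, *, le_of_lt]

theorem occurs_pat2314_iff {l : V ≃ α} : Occurs l pat2314 ↔
    ∃ a b c d, a < b ∧ b < c ∧ c < d ∧ l c < l a ∧ l a < l b ∧ l b < l d := by
  constructor
  · rintro ⟨(v : Fin 4 → V), (hv : ∀ i j : Fin 4, i.val + 1 = j.val → v i ≤ v j), hl⟩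
    change ∀ i j : Fin 4, _ ↔ (![2, 3, 1, 4] : Fin 4 → ℕ) i < (![2, 3, 1, 4] : Fin 4 → ℕ) j at hl
    have h20 : l (v 2) < l (v 0) := (hl 2 0).2 (by decide)
    have h01 : l (v 0) < l (v 1) := (hl 0 1).2 (by decide)
    have h13 : l (v 1) < l (v 3) := (hl 1 3).2 (by decide)
    exact ⟨v 0, v 1, v 2, v 3, lt_of_le_of_label_ne (hv 0 1 rfl) h01.ne,
      lt_of_le_of_label_ne (hv 1 2 rfl) (h20.trans h01).ne',
      lt_of_le_of_label_ne (hv 2 3 rfl) (h20.trans (h01.trans h13)).ne, h20, h01, h13⟩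
  · rintro ⟨a, b, c, d, hab, hbc, hcd, h1, h2, h3⟩
    have h12 := h1.trans h2
    have h23 := h2.trans h3
    have h123 := h1.trans h23
    refine ⟨![a, b, c, d], ?_, ?_⟩
    · change ∀ i j : Fin 4, _
      simp [Fin.forall_fin_succ, hab.le, hbc.le, hcd.le]
    · change ∀ i j : Fin 4, _ ↔ (![2, 3, 1, 4] : Fin 4 → ℕ) i < (![2, 3, 1, 4] : Fin 4 → ℕ) j
      simp [Fin.forall_fin_succ, *, le_of_lt]

theorem occurs_pat3142_iff {l : V ≃ α} : Occurs l pat3142 ↔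
    ∃ a b c d, a < b ∧ b < c ∧ c < d ∧ l b < l d ∧ l d < l a ∧ l a < l c := by
  constructor
  · rintro ⟨(v : Fin 4 → V), (hv : ∀ i j : Fin 4, i.val + 1 = j.val → v i ≤ v j), hl⟩
    change ∀ i j : Fin 4, _ ↔ (![3, 1, 4, 2] : Fin 4 → ℕ) i < (![3, 1, 4, 2] : Fin 4 → ℕ) j at hl
    have h13 : l (v 1) < l (v 3) := (hl 1 3).2 (by decide)
    have h30 : l (v 3) < l (v 0) := (hl 3 0).2 (by decide)
    have h02 : l (v 0) < l (v 2) := (hl 0 2).2 (by decide)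
    exact ⟨v 0, v 1, v 2, v 3, lt_of_le_of_label_ne (hv 0 1 rfl) (h13.trans h30).ne',
      lt_of_le_of_label_ne (hv 1 2 rfl) (h13.trans (h30.trans h02)).ne,
      lt_of_le_of_label_ne (hv 2 3 rfl) (h30.trans h02).ne', h13, h30, h02⟩
  · rintro ⟨a, b, c, d, hab, hbc, hcd, h1, h2, h3⟩
    have h12 := h1.trans h2
    have h23 := h2.trans h3
    have h123 := h1.trans h23
    refine ⟨![a, b, c, d], ?_, ?_⟩
    · change ∀ i j : Fin 4, _
      simp [Fin.forall_fin_succ, hab.le, hbc.le, hcd.le]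
    · change ∀ i j : Fin 4, _ ↔ (![3, 1, 4, 2] : Fin 4 → ℕ) i < (![3, 1, 4, 2] : Fin 4 → ℕ) j
      simp [Fin.forall_fin_succ, *, le_of_lt]

theorem occurs_pat3124_iff {l : V ≃ α} : Occurs l pat3124 ↔
    ∃ a b c d, a < b ∧ b < c ∧ c < d ∧ l b < l c ∧ l c < l a ∧ l a < l d := by
  constructor
  · rintro ⟨(v : Fin 4 → V), (hv : ∀ i j : Fin 4, i.val + 1 = j.val → v i ≤ v j), hl⟩
    change ∀ i j : Fin 4, _ ↔ (![3, 1, 2, 4] : Fin 4 → ℕ) i < (![3, 1, 2, 4] : Fin 4 → ℕ) j at hl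
    have h12 : l (v 1) < l (v 2) := (hl 1 2).2 (by decide)
    have h20 : l (v 2) < l (v 0) := (hl 2 0).2 (by decide)
    have h03 : l (v 0) < l (v 3) := (hl 0 3).2 (by decide)
    exact ⟨v 0, v 1, v 2, v 3, lt_of_le_of_label_ne (hv 0 1 rfl) (h12.trans h20).ne',
      lt_of_le_of_label_ne (hv 1 2 rfl) h12.ne,
      lt_of_le_of_label_ne (hv 2 3 rfl) (h20.trans h03).ne, h12, h20, h03⟩
  · rintro ⟨a, b, c, d, hab, hbc, hcd, h1, h2, h3⟩
    have h12 := h1.trans h2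
    have h23 := h2.trans h3
    have h123 := h1.trans h23
    refine ⟨![a, b, c, d], ?_, ?_⟩
    · change ∀ i j : Fin 4, _
      simp [Fin.forall_fin_succ, hab.le, hbc.le, hcd.le]
    · change ∀ i j : Fin 4, _ ↔ (![3, 1, 2, 4] : Fin 4 → ℕ) i < (![3, 1, 2, 4] : Fin 4 → ℕ) j
      simp [Fin.forall_fin_succ, *, le_of_lt]

theorem extremal_univ_iff {l : V ≃ α} : Extremal Set.univ l ↔ ¬ Occurs l pat123 := by
  rw [occurs_pat123_iff]
  constructor
  · rintro h ⟨a, b, c, hab, hbc, h1, h2⟩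
    exact ((h b c ⟨le_rfl, a, hab, h1⟩ ⟨hbc.le, a, hab, h1.trans h2⟩).1 trivial).not_gt h2
  · rintro h u d ⟨-, a, ha, hau⟩ ⟨hud, -⟩
    refine ⟨fun _ => ?_, fun H => absurd (Set.mem_univ u) H⟩
    by_contra! hlt
    exact h ⟨a, u, d, ha, lt_of_le_of_label_ne hud hlt.ne, hau, hlt⟩

theorem extremal_empty_iff {l : V ≃ α} : Extremal ∅ l ↔ ¬ Occurs l pat132 := by
  rw [occurs_pat132_iff]
  constructor
  · rintro h ⟨a, b, c, hab, hbc, h1, h2⟩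
    exact ((h b c ⟨le_rfl, a, hab, h1.trans h2⟩ ⟨hbc.le, a, hab, h1⟩).2 (by simp)).not_gt h2
  · rintro h u d - ⟨hud, a, ha, had⟩
    refine ⟨fun H => absurd H (by simp), fun _ => ?_⟩
    by_contra! hlt
    exact h ⟨a, u, d, ha, lt_of_le_of_label_ne hud hlt.ne', had, hlt⟩

theorem label_lt_of_not_above_self {l : V ≃ α} {a v : V} (hv : ¬ Above l v v) (ha : a < v) :
    l v < l a :=
  lt_of_le_of_ne (le_of_not_above_self hv ha) fun H => ha.ne' (l.injective H)

/-- In a 2413 `a, b, c, d`, the vertex `c` is a top-down minimum, since otherwise `c, d` would end a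
123. Conversely maximality at `u` places `l d` below `l u`, which yields 2413. -/
theorem noMinimumBetween_iff_of_extremal_univ {l : V ≃ α} (hl : Extremal Set.univ l) :
    NoMinimumBetween l ↔ ¬ Occurs l pat2413 := by
  rw [occurs_pat2413_iff]
  constructor
  · rintro h ⟨a, b, c, d, hab, hbc, hcd, h1, h2, h3⟩
    refine h b c d ⟨le_rfl, a, hab, h2.trans h3⟩ ⟨(hbc.trans hcd).le, a, hab, h2⟩ ?_ hbc hcd
    intro hc
    obtain ⟨-, x, hx, hxc⟩ := id hc
    exact ((hl c d hc ⟨hcd.le, x, hx, hxc.trans (h1.trans h2)⟩).1 trivial).not_gt (h1.trans h2)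
  · intro h u c d hu hd hc huc hcd
    have hdu := (hl u d hu hd).1 trivial
    obtain ⟨-, a, ha, had⟩ := hd
    exact h ⟨a, u, c, d, ha, huc, hcd, label_lt_of_not_above_self hc (ha.trans huc), had,
      lt_of_le_of_ne hdu fun H => (huc.trans hcd).ne' (l.injective H)⟩

theorem sameSide_iff_of_extremal_univ (chain : ∀ a b c : V, a ≤ c → b ≤ c → a ≤ b ∨ b ≤ a)
    {l : V ≃ α} (hl : Extremal Set.univ l) : SameSide l ↔ ¬ Occurs l pat3142 := by
  rw [occurs_pat3142_iff]
  constructor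
  · rintro h ⟨a, b, c, d, hab, hbc, hcd, h1, h2, h3⟩
    have hc : Above l c c := ⟨le_rfl, b, hbc, h1.trans (h2.trans h3)⟩
    -- Otherwise `a, c` would end a 123.
    have ha : ¬ Above l a a := by
      intro ha
      obtain ⟨-, x, hx, hxa⟩ := id ha
      exact ((hl a c ha ⟨(hab.trans hbc).le, x, hx, hxa.trans h3⟩).1 trivial).not_gt h3
    exact h2.not_gt ((h a c d (hab.trans hbc) hc ⟨hcd.le, b, hbc, h1⟩ ha).2 h3)
  · intro h a u d hau hu hd ha
    have hdu := (hl u d hu hd).1 trivial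
    refine ⟨fun H => H.trans_le hdu, fun H => ?_⟩
    obtain ⟨hud, b, hb, hbd⟩ := hd
    by_contra! hda
    -- The witness `b` for `d` has a label below that of the minimum `a`, hence lies between `a` and
    -- `u`.
    have hda : l d < l a := lt_of_le_of_ne hda fun H' => (hau.trans_le hud).ne' (l.injective H')
    have hab : a < b := by
      rcases chain a b u hau.le hb.le with hab | hab
      · exact lt_of_le_of_label_ne hab (hbd.trans hda).ne'
      · have hba := lt_of_le_of_label_ne hab (hbd.trans hda).ne
        exact absurd (label_lt_of_not_above_self ha hba) (hbd.trans hda).not_gt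
    exact h ⟨a, b, u, d, hab, hb, lt_of_le_of_label_ne hud (hda.trans H).ne', hbd, hda, H⟩

section Finite

variable [Finite V]

theorem noMinimumBetween_iff_of_extremal_empty
    (chain : ∀ a b c : V, a ≤ c → b ≤ c → a ≤ b ∨ b ≤ a) {l : V ≃ α} (hl : Extremal ∅ l) :
    NoMinimumBetween l ↔ ¬ Occurs l pat2314 := by
  rw [occurs_pat2314_iff]
  constructor
  · rintro h ⟨a, b, c, d, hab, hbc, hcd, h1, h2, h3⟩
    have hb : Above l b b := ⟨le_rfl, a, hab, h2⟩
    -- Here `c` need not be a top-down minimum, so the smallest-labeled ancestor `x` of `c` replaces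
    -- it. It lies strictly below `b` in the tree, as otherwise `x, b, c` would be a 132.
    obtain ⟨x, hxc, hx, hlx⟩ := exists_minimum_le l c
    have hbx : b < x := by
      rcases chain b x c hbc.le hxc with hbx | hbx
      · exact lt_of_le_of_label_ne hbx (hlx.trans_lt (h1.trans h2)).ne'
      · have hxb := lt_of_le_of_label_ne hbx (hlx.trans_lt (h1.trans h2)).ne
        have hxc' : l x < l c :=
          lt_of_le_of_ne hlx fun H => (hxb.trans hbc).ne (l.injective H)
        exact absurd ((hl b c hb ⟨hbc.le, x, hxb, hxc'⟩).2 (by simp)) (h1.trans h2).not_ge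
    exact h b x d hb ⟨(hbc.trans hcd).le, a, hab, h2.trans h3⟩ hx hbx (hxc.trans_lt hcd)
  · intro h u c d hu hd hc huc hcd
    have hud := (hl u d hu hd).2 (by simp)
    obtain ⟨-, a, ha, hau⟩ := hu
    exact h ⟨a, u, c, d, ha, huc, hcd, label_lt_of_not_above_self hc (ha.trans huc), hau,
      lt_of_le_of_ne hud fun H => (huc.trans hcd).ne (l.injective H)⟩

theorem sameSide_iff_of_extremal_empty (chain : ∀ a b c : V, a ≤ c → b ≤ c → a ≤ b ∨ b ≤ a)
    {l : V ≃ α} (hl : Extremal ∅ l) : SameSide l ↔ ¬ Occurs l pat3124 := by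
  rw [occurs_pat3124_iff]
  constructor
  · rintro h ⟨a, b, c, d, hab, hbc, hcd, h1, h2, h3⟩
    have hc : Above l c c := ⟨le_rfl, b, hbc, h1⟩
    have hac := hab.trans hbc
    obtain ⟨x, hxa, hx, hlx⟩ := exists_minimum_le l a
    -- A minimum `x` above `a` stands in for `a`; if `l x < l c`, then `x, a, c` would be a 132.
    -- Thus `x` separates the labels of `c` and `d`.
    have hcx : l c ≤ l x := by
      by_contra! hxc
      have hxa' := lt_of_le_of_label_ne hxa (hxc.trans h2).ne
      exact ((hl a c ⟨le_rfl, x, hxa', hxc.trans h2⟩ ⟨hac.le, x, hxa', hxc⟩).2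
        (by simp)).not_gt h2
    have hd : Above l c d := ⟨hcd.le, b, hbc, h1.trans (h2.trans h3)⟩
    exact hcx.not_gt ((h x c d (hxa.trans_lt hac) hc hd hx).1 (hlx.trans_lt h3))
  · intro h a u d hau hu hd ha
    have hud := (hl u d hu hd).2 (by simp)
    refine ⟨fun H => ?_, fun H => H.trans_le hud⟩
    obtain ⟨-, b, hb, hbu⟩ := hu
    by_contra! hua
    have hua : l u < l a := lt_of_le_of_ne hua fun H' => hau.ne' (l.injective H')
    have hab : a < b := by
      rcases chain a b u hau.le hb.le with hab | hab
      · exact lt_of_le_of_label_ne hab (hbu.trans hua).ne'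
      · have hba := lt_of_le_of_label_ne hab (hbu.trans hua).ne
        exact absurd (label_lt_of_not_above_self ha hba) (hbu.trans hua).not_gt
    exact h ⟨a, b, u, d, hab, hb, lt_of_le_of_label_ne hd.1 (hua.trans H).ne, hbu, hua, H⟩

theorem card_avoiding_pat123_pat2413 (chain : ∀ a b c : V, a ≤ c → b ≤ c → a ≤ b ∨ b ≤ a) :
    Nat.card {l : V ≃ α // ¬ Occurs l pat123 ∧ ¬ Occurs l pat2413} =
      Nat.card {l : V ≃ α // ¬ Occurs l pat132 ∧ ¬ Occurs l pat2314} := by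
  have h₁ (l : V ≃ α) : ¬ Occurs l pat123 ∧ ¬ Occurs l pat2413 ↔
      NoMinimumBetween l ∧ Extremal Set.univ l := by
    rw [← extremal_univ_iff, and_comm]
    exact and_congr_left fun h => (noMinimumBetween_iff_of_extremal_univ h).symm
  have h₂ (l : V ≃ α) : ¬ Occurs l pat132 ∧ ¬ Occurs l pat2314 ↔
      NoMinimumBetween l ∧ Extremal ∅ l := by
    rw [← extremal_empty_iff, and_comm]
    exact and_congr_left fun h => (noMinimumBetween_iff_of_extremal_empty chain h).symm
  simp only [h₁, h₂]
  exact card_extremal_univ chain fun _ _ _ h => h.noMinimumBetween chain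

theorem card_avoiding_pat123_pat3142 (chain : ∀ a b c : V, a ≤ c → b ≤ c → a ≤ b ∨ b ≤ a) :
    Nat.card {l : V ≃ α // ¬ Occurs l pat123 ∧ ¬ Occurs l pat3142} =
      Nat.card {l : V ≃ α // ¬ Occurs l pat132 ∧ ¬ Occurs l pat3124} := by
  have h₁ (l : V ≃ α) : ¬ Occurs l pat123 ∧ ¬ Occurs l pat3142 ↔
      SameSide l ∧ Extremal Set.univ l := by
    rw [← extremal_univ_iff, and_comm]
    exact and_congr_left fun h => (sameSide_iff_of_extremal_univ chain h).symm
  have h₂ (l : V ≃ α) : ¬ Occurs l pat132 ∧ ¬ Occurs l pat3124 ↔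
      SameSide l ∧ Extremal ∅ l := by
    rw [← extremal_empty_iff, and_comm]
    exact and_congr_left fun h => (sameSide_iff_of_extremal_empty chain h).symm
  simp only [h₁, h₂]
  exact card_extremal_univ chain fun _ _ _ h => h.sameSide chain

end Finite

end ForestLabeling

/-! ### From labelings of a fixed shape to counts of forests -/

namespace RootedForest

variable {α β : Type*}

/-- The vertices of a forest, ordered by ancestry. -/
def Vertex (_F : RootedForest α) : Type _ := α

instance (F : RootedForest α) : PartialOrder F.Vertex where
  le := F.IsAncestor
  le_refl _ := .refl
  le_trans _ _ _ := .trans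
  le_antisymm a b hab hba := by
    by_contra hne
    rcases Relation.reflTransGen_iff_eq_or_transGen.1 hab with h | h
    · exact hne h.symm
    · exact F.wf.transGen.irrefl.irrefl a (h.trans_left hba)

instance (F : RootedForest α) [h : Finite α] : Finite F.Vertex := h

/-- A vertex has at most one parent, so the path upward from `c` is unique. -/
theorem le_total_of_le (F : RootedForest α) (a b c : F.Vertex) (ha : a ≤ c) (hb : b ≤ c) :
    a ≤ b ∨ b ≤ a := by
  have U : Relator.RightUnique (Function.swap fun x y : α => F.parent y = some x) := by
    intro x y z hy hz
    exact Option.some.inj (hy.symm.trans hz)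
  exact (Relation.ReflTransGen.total_of_right_unique U (Relation.reflTransGen_swap.2 ha)
    (Relation.reflTransGen_swap.2 hb)).symm.imp Relation.reflTransGen_swap.1
    Relation.reflTransGen_swap.1

/-- Replace the label `v` by `l v`. -/
def relabel (F : RootedForest β) (l : β ≃ α) : RootedForest α where
  parent x := (F.parent (l.symm x)).map l
  wf := by
    refine Subrelation.wf ?_ (InvImage.wf l.symm F.wf)
    intro u v h
    obtain ⟨w, hw, rfl⟩ := Option.map_eq_some_iff.1 h
    simpa [InvImage] using hw

theorem relabel_relabel_symm (F : RootedForest β) (l : β ≃ α) :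
    (F.relabel l).relabel l.symm = F := by
  ext1
  funext x
  simp [relabel]

theorem relabel_symm_relabel (F : RootedForest α) (l : β ≃ α) :
    (F.relabel l.symm).relabel l = F := by
  ext1
  funext x
  simp [relabel]

theorem IsAncestor.relabel {F : RootedForest β} {a b : β} (h : F.IsAncestor a b) (l : β ≃ α) :
    (F.relabel l).IsAncestor (l a) (l b) :=
  Relation.ReflTransGen.lift l (fun x y hxy => by
    simp [Function.onFun, RootedForest.relabel, show F.parent y = some x from hxy]) _ _ h

theorem isAncestor_relabel_iff (F : RootedForest β) (l : β ≃ α) {a b : β} :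
    (F.relabel l).IsAncestor (l a) (l b) ↔ F.IsAncestor a b := by
  refine ⟨fun h => ?_, fun h => h.relabel l⟩
  simpa [relabel_relabel_symm] using h.relabel l.symm

theorem contains_relabel_iff [LinearOrder α] (F : RootedForest β) (l : β ≃ α) (π : Pattern) :
    (F.relabel l).Contains π ↔ ForestLabeling.Occurs (V := F.Vertex) l π := by
  constructor
  · rintro ⟨v, hv, hl⟩
    refine ⟨fun i => l.symm (v i), fun i j hij => ?_, fun i j => ?_⟩
    · exact (F.isAncestor_relabel_iff l).1 (by simpa using hv i j hij)
    · exact (iff_of_eq (congrArg₂ (· < ·) (l.apply_symm_apply _) (l.apply_symm_apply _))).trans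
        (hl i j)
  · rintro ⟨v, hv, hl⟩
    exact ⟨fun i => l (v i), fun i j hij => (F.isAncestor_relabel_iff l).2 (hv i j hij), hl⟩

theorem avoids_pair_relabel_iff [LinearOrder α] (F : RootedForest β) (l : β ≃ α)
    (π ρ : Pattern) : (F.relabel l).Avoids {π, ρ} ↔
      ¬ ForestLabeling.Occurs (V := F.Vertex) l π ∧
        ¬ ForestLabeling.Occurs (V := F.Vertex) l ρ := by
  simp [Avoids, contains_relabel_iff]

/-- A forest with a relabeling that avoids `S` amounts to an avoiding forest and a permutation. -/
def avoidingRelabelEquiv [LinearOrder α] (S : Set Pattern) :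
    {p : RootedForest α × Equiv.Perm α // (p.1.relabel p.2).Avoids S} ≃
      {F : RootedForest α // F.Avoids S} × Equiv.Perm α where
  toFun p := (⟨p.1.1.relabel p.1.2, p.2⟩, p.1.2)
  invFun q := ⟨(q.1.1.relabel q.2.symm, q.2), by
    rw [relabel_symm_relabel]
    exact q.1.2⟩
  left_inv p := by simp [relabel_relabel_symm]
  right_inv q := by simp [relabel_symm_relabel]

/-- For each permutation, relabeling is a bijection on forests, so each avoiding forest is counted
once per permutation. Counting pairs avoids any division by automorphisms of the shape. -/
theorem forestCount_mul_card_perm (n : ℕ) (S : Set Pattern) :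
    forestCount n S * Nat.card (Equiv.Perm (Fin n)) =
      Nat.card (Σ F : RootedForest (Fin n),
        {l : Equiv.Perm (Fin n) // (F.relabel l).Avoids S}) := by
  rw [forestCount, ← Nat.card_prod, ← Nat.card_congr (avoidingRelabelEquiv S)]
  exact Nat.card_congr (Equiv.subtypeProdEquivSigmaSubtype
    fun (F : RootedForest (Fin n)) (l : Equiv.Perm (Fin n)) => (F.relabel l).Avoids S)

theorem forestWilfEquiv_of_card_relabel {S T : Set Pattern}
    (h : ∀ (n : ℕ) (F : RootedForest (Fin n)),
      Nat.card {l : Equiv.Perm (Fin n) // (F.relabel l).Avoids S} =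
        Nat.card {l : Equiv.Perm (Fin n) // (F.relabel l).Avoids T}) : ForestWilfEquiv S T := by
  intro n
  refine Nat.eq_of_mul_eq_mul_right (Nat.card_pos (α := Equiv.Perm (Fin n))) ?_
  rw [forestCount_mul_card_perm, forestCount_mul_card_perm]
  have := Fintype.ofFinite (RootedForest (Fin n))
  rw [Nat.card_sigma, Nat.card_sigma]
  exact Finset.sum_congr rfl fun F _ => h n F

end RootedForest

theorem theorem3p2 :
    ForestWilfEquiv {pat123, pat2413} {pat132, pat2314} ∧
      ForestWilfEquiv {pat123, pat3142} {pat132, pat3124} := by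
  constructor
  · refine RootedForest.forestWilfEquiv_of_card_relabel fun n F => ?_
    simp only [RootedForest.avoids_pair_relabel_iff]
    exact ForestLabeling.card_avoiding_pat123_pat2413 (V := F.Vertex) F.le_total_of_le
  · refine RootedForest.forestWilfEquiv_of_card_relabel fun n F => ?_
    simp only [RootedForest.avoids_pair_relabel_iff]
    exact ForestLabeling.card_avoiding_pat123_pat3142 (V := F.Vertex) F.le_total_of_le
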